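/- Let $q$ be a prime power, let $\alpha\in\mathbb F_q$ be a primitive $n$-th root of unity (so $n\mid q-1$; for instance $n=q-1$), and for $1\le k\le n$ and $b\ge 0$ let $RS_k(n,b)$ be the Reed--Solomon code of length $n$ over $\mathbb F_q$, that is, the cyclic code with generator polynomial $(x-\alpha^{b})(x-\alpha^{b+1})\cdots(x-\alpha^{b+n-k-1})$. An $[[n,k,d;c]]_q$ QUENTA (entanglement-assisted quantum) code is given by an isometry $V$ from $k+c$ to $n$ qudits of dimension $q$; it encodes a state $|\varphi\rangle$ of $k$ qudits as $(V\otimes I)(|\varphi\rangle\otimes|\Phi\rangle)$, where $|\Phi\rangle=q^{-c/2}\sum_{e\in\mathbb F_q^c}|e\rangle|e\rangle$ consists of $c$ maximally entangled pairs whose second halves are held, free of errors, by the receiver. Its minimum distance is $d$: every error $E$ on fewer than $d$ of the $n$ qudits is detected, i.e. $P(E\otimes I)P=\lambda_E P$ for the projector $P$ onto the code space, and some error on $d$ of the qudits is not detected. (For $k=0$, detection means by convention that also $\lambda_E=q^{-n}\operatorname{tr}E$.) Linear codes $C_1,C_2\subseteq\mathbb F_q^n$ give such a code (Euclidean construction)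 if it can be chosen so that for each $a\in C_1^\perp$ some $X(a)\otimes X(u)$, and for each $b\in C_2^\perp$ some $Z(b)\otimes Z(v)$, with $u,v\in\mathbb F_q^c$, fixes all encoded states. Here $X(w)|y\rangle=|y+w\rangle$ and $Z(w)|y\rangle=\chi(w\cdot y)|y\rangle$, $u$ depends only on $a$, $v$ depends only on $b$, and the latter holds for every additive character $\chi$ of $\mathbb F_q$. **Theorem.** Let $C_1=RS_{k_1}(n,b_1)$ and $C_2=RS_{k_2}(n,b_2)$ be Reed--Solomon codes over $\mathbb F_q$ with $1\le k_1,k_2\le n$, $0\le b_1\le k_1$, $b_2\ge 0$ and $b_1+b_2\le k_2+1$. 1. If $k_1-b_1\ge b_2$, and if $b_1+b_2-1\ge 0$ and $n+b_1+b_2-k_1-k_2-1\ge 0$, then $C_1$ and $C_2$ give a QUENTA code with parameters $$[[n,\ b_1+b_2-1,\ n-\max\{k_1,k_2\}+1;\ n+b_1+b_2-k_1-k_2-1]]_q .$$ 2. If $k_1-b_1<b_2$, then $C_1$ and $C_2$ give a QUENTA code with parameters $$[[n,\ k_1,\ n-\max\{k_1,k_2\}+1;\ n-k_2]]_q .$$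 -/

import Mathlib

open scoped Matrix Kronecker

section LinearCodes

/-- Generator polynomial `(X - α^b)(X - α^(b+1)) ⋯ (X - α^(b+n-k-1))` of the Reed-Solomon code
`RS_k(n, b)`, where `α` is a primitive `n`-th root of unity. -/
noncomputable def rsGenerator {F : Type*} [Field F] (α : F) (n k b : ℕ) : Polynomial F :=
  ∏ i ∈ Finset.range (n - k), (Polynomial.X - Polynomial.C (α ^ (b + i)))

/-- The polynomial `v_0 + v_1 X + ⋯ + v_{n-1} X^(n-1)` of a vector `v ∈ F^n`. -/
noncomputable def wordPoly {F : Type*} [Field F] {n : ℕ} (v : Fin n → F) : Polynomial F :=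
  ∑ i, Polynomial.C (v i) * Polynomial.X ^ (i : ℕ)

/-- The Reed-Solomon code `RS_k(n, b)`: the cyclic code of length `n` that is generated by
`rsGenerator α n k b`. -/
noncomputable def reedSolomon {F : Type*} [Field F] (α : F) (n k b : ℕ) :
    Submodule F (Fin n → F) where
  carrier := {v | rsGenerator α n k b ∣ wordPoly v}
  zero_mem' := by simp [wordPoly]
  add_mem' := by
    intro v w hv hw
    have h : wordPoly (v + w) = wordPoly v + wordPoly w := by
      simp [wordPoly, add_mul, Finset.sum_add_distrib]
    simpa only [Set.mem_ofPred_eq, h] using dvd_add hv hw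
  smul_mem' := by
    intro a v hv
    have h : wordPoly (a • v) = Polynomial.C a * wordPoly v := by
      simp [wordPoly, Finset.mul_sum, mul_assoc]
    simpa only [Set.mem_ofPred_eq, h] using Dvd.dvd.mul_left hv _

/-- The Euclidean dual `C^⊥`. -/
def euclideanDual {F : Type*} [Field F] {n : ℕ} (C : Submodule F (Fin n → F)) :
    Submodule F (Fin n → F) where
  carrier := {a | ∀ v ∈ C, a ⬝ᵥ v = 0}
  zero_mem' := by simp
  add_mem' := by
    intro a b ha hb v hv
    rw [add_dotProduct, ha v hv, hb v hv, add_zero]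
  smul_mem' := by
    intro r a ha v hv
    rw [smul_dotProduct, ha v hv, smul_zero]

end LinearCodes

section Quantum

/-! The state space of `m` qudits of dimension `q = |F|` has the orthonormal basis
`|x⟩`, `x : Fin m → F`. An encoder for `k` logical qudits, `c` maximally entangled pairs and `n`
physical qudits is an isometry `V` from `k + c` qudits (the logical qudits and the sender's halves
of the pairs; the ancillas in state `|0⟩` are absorbed in `V`) to `n` qudits. -/

/-- The encoded basis state `(V ⊗ I) (|x⟩ ⊗ |Φ⟩)` on `n + c` qudits, where
`|Φ⟩ = q^(-c/2) ∑ e, |e⟩ ⊗ |e⟩` consists of `c` maximally entangled pairs, whose second halves are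
held by the receiver. -/
noncomputable def encodedState {F : Type*} [Fintype F] {n k c : ℕ}
    (V : Matrix (Fin n → F) ((Fin k → F) × (Fin c → F)) ℂ) (x : Fin k → F) :
    (Fin n → F) × (Fin c → F) → ℂ :=
  fun p => V p.1 (x, p.2) / ((Real.sqrt ((Fintype.card F : ℝ) ^ c) : ℝ) : ℂ)

/-- `E` is an operator on `n` qudits of the form `M ⊗ I`, where `M` acts on the qudits in `S`. -/
def ActsOn {F : Type*} [DecidableEq F] {n : ℕ} (S : Finset (Fin n))
    (E : Matrix (Fin n → F) (Fin n → F) ℂ) : Prop :=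
  ∃ M : Matrix (S → F) (S → F) ℂ, ∀ x y : Fin n → F,
    E x y = if ∀ i, i ∉ S → x i = y i then M (fun i => x i) (fun i => y i) else 0

/-- The code detects the error `E` on the `n` transmitted qudits (the receiver's `c` qudits are
error-free): the compression of `E ⊗ I` to the code space is a scalar `lam`. For `k = 0`, where the
code is a single state, the usual convention for zero-dimensional codes is made: the scalar has to
be the normalised trace of `E`, that is, the code has to be pure. -/
def Detects {F : Type*} [Fintype F] [DecidableEq F] {n k c : ℕ}
    (V : Matrix (Fin n → F) ((Fin k → F) × (Fin c → F)) ℂ)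
    (E : Matrix (Fin n → F) (Fin n → F) ℂ) : Prop :=
  ∃ lam : ℂ,
    (∀ x y : Fin k → F,
      star (encodedState V x) ⬝ᵥ
        ((E ⊗ₖ (1 : Matrix (Fin c → F) (Fin c → F) ℂ)) *ᵥ encodedState V y)
        = if x = y then lam else 0) ∧
    (k = 0 → lam = E.trace / (Fintype.card F : ℂ) ^ n)

/-- `V` encodes an `[[n, k, d; c]]_q` entanglement-assisted code, `q = |F|`: `V` is an isometry,
and the minimum distance is `d`, i.e. all errors on fewer than `d` qudits are detected, and some
error on `d` qudits is not. -/
structure IsQuentaCode {F : Type*} [Fintype F] [DecidableEq F] (n k d c : ℕ)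
    (V : Matrix (Fin n → F) ((Fin k → F) × (Fin c → F)) ℂ) : Prop where
  isometry : Vᴴ * V = 1
  detects : ∀ (S : Finset (Fin n)) (E : Matrix (Fin n → F) (Fin n → F) ℂ),
    S.card < d → ActsOn S E → Detects V E
  not_detects : ∃ (S : Finset (Fin n)) (E : Matrix (Fin n → F) (Fin n → F) ℂ),
    S.card = d ∧ ActsOn S E ∧ ¬ Detects V E

/-- `V` encodes a code obtained from `C₁` and `C₂` by the Euclidean construction: it is
stabilised by shifts `X(a) ⊗ X(u)` with `a ∈ C₁^⊥` and by phases `Z(b) ⊗ Z(v)` with `b ∈ C₂^⊥`,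
for suitable extensions `u`, `v` of these operators to the receiver's qudits. -/
structure IsEuclideanConstruction {F : Type*} [Field F] [Fintype F] {n k c : ℕ}
    (C₁ C₂ : Submodule F (Fin n → F))
    (V : Matrix (Fin n → F) ((Fin k → F) × (Fin c → F)) ℂ) : Prop where
  shift : ∀ a ∈ euclideanDual C₁, ∃ u : Fin c → F, ∀ (x : Fin k → F) (y : Fin n → F)
    (z : Fin c → F), encodedState V x (y - a, z - u) = encodedState V x (y, z)
  phase : ∀ b ∈ euclideanDual C₂, ∃ v : Fin c → F, ∀ (χ : AddChar F ℂ) (x : Fin k → F)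
    (y : Fin n → F) (z : Fin c → F),
    χ (b ⬝ᵥ y + v ⬝ᵥ z) * encodedState V x (y, z) = encodedState V x (y, z)

/-- The codes `C₁` and `C₂` give an `[[n, k, d; c]]_q` QUENTA code. -/
def GivesQuentaCode {F : Type*} [Field F] [Fintype F] [DecidableEq F] {n : ℕ}
    (C₁ C₂ : Submodule F (Fin n → F)) (k d c : ℕ) : Prop :=
  ∃ V : Matrix (Fin n → F) ((Fin k → F) × (Fin c → F)) ℂ,
    IsQuentaCode n k d c V ∧ IsEuclideanConstruction C₁ C₂ V

end Quantum

/-! The words `e s = (α^(s j))_j` form a basis of `F^n` with dual basis `f s = n⁻¹ (α^(-s j))_j`. In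
these bases `C₁^⊥` is spanned by the `e s` with `s ∈ A`, the zero frequencies of `C₁`, and `C₂^⊥` by
the `f s` with `s ∈ B`, the negatives modulo `n` of the zero frequencies of `C₂`. Shifts along `e s`
and phases along `f t` can fail to commute only if `s = t`. So each frequency in `A ∩ B` costs one
maximally entangled pair, and each frequency outside `A ∪ B` carries a logical qudit. The encoded
states superpose the `y` whose `f`-coordinates are zero on `B \ A`, agree with the receiver on `A ∩
B`, are the logical value outside `A ∪ B`, and are free on `A \ B`
(`givesQuentaCode_of_biorthogonal`).

Errors on `S` are detected once `C₂` has no nonzero word supported in `S` and `C₁^⊥` restricts onto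
`F^S` (`cssEncoder_detects`). For `|S| ≤ n - max k₁ k₂` both follow from Lagrange interpolation
(`exists_sum_freqVec_eqOn`). Conversely, the generator polynomial of the code of larger dimension
has at most `n - max k₁ k₂ + 1` nonzero coefficients, and it vanishes at no frequency outside its
defining set. Used as a shift or a phase, it therefore disturbs every logical qudit. What remains is
to count `A ∩ B` and the complement of `A ∪ B`, which are explicit intervals. -/

section CSS

/-! ### CSS encoders with entanglement, described by a linear coordinate map. -/

variable {F : Type*} [Field F] [Fintype F] [DecidableEq F] {n k c : ℕ}
  {M : Type*} [AddCommGroup M] [Module F M] [DecidableEq M]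

/-- The encoder of the CSS code whose encoded basis states `x` are the uniform superpositions of
all `|y⟩ ⊗ |z⟩` with `Θ y = (0, z, x)`. -/
noncomputable def cssEncoder (Θ : (Fin n → F) →ₗ[F] M × (Fin c → F) × (Fin k → F)) :
    Matrix (Fin n → F) ((Fin k → F) × (Fin c → F)) ℂ :=
  fun y p => if Θ y = (0, p.2, p.1) then
    ((Real.sqrt (Finset.univ.filter fun y => Θ y = 0).card : ℝ) : ℂ)⁻¹ else 0

/-- Fibres of a surjective linear map are translates of the kernel; this makes one normalisation
constant serve all columns of the encoder. -/
lemma card_fiber_eq_card_ker (Θ : (Fin n → F) →ₗ[F] M × (Fin c → F) × (Fin k → F))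
    (hΘ : Function.Surjective Θ) (p : M × (Fin c → F) × (Fin k → F)) :
    (Finset.univ.filter fun y => Θ y = p).card = (Finset.univ.filter fun y => Θ y = 0).card := by
  obtain ⟨y₀, rfl⟩ := hΘ p
  refine Finset.card_bij' (fun y _ => y - y₀) (fun y _ => y + y₀) ?_ ?_ ?_ ?_ <;>
    simp +contextual

lemma card_ker_ne_zero (Θ : (Fin n → F) →ₗ[F] M × (Fin c → F) × (Fin k → F)) :
    ((Finset.univ.filter fun y => Θ y = 0).card : ℂ) ≠ 0 := by
  rw [Nat.cast_ne_zero]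
  exact Finset.card_ne_zero_of_mem (a := 0) (by simp)

lemma inv_sqrt_mul_inv_sqrt (m : ℕ) :
    ((Real.sqrt m : ℝ) : ℂ)⁻¹ * ((Real.sqrt m : ℝ) : ℂ)⁻¹ = (m : ℂ)⁻¹ := by
  rw [← mul_inv, ← Complex.ofReal_mul, Real.mul_self_sqrt (Nat.cast_nonneg m),
    Complex.ofReal_natCast]

lemma cssEncoder_isometry (Θ : (Fin n → F) →ₗ[F] M × (Fin c → F) × (Fin k → F))
    (hΘ : Function.Surjective Θ) : (cssEncoder Θ)ᴴ * cssEncoder Θ = 1 := by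
  ext p p'
  rw [Matrix.mul_apply, Matrix.one_apply]
  simp only [Matrix.conjTranspose_apply, cssEncoder, apply_ite star, star_zero, star_inv₀,
    Complex.star_def, Complex.conj_ofReal, mul_ite, ite_mul, zero_mul, mul_zero,
    inv_sqrt_mul_inv_sqrt]
  split_ifs with h
  · subst h
    simp only [← ite_and, and_self]
    rw [← Finset.sum_filter, Finset.sum_const, card_fiber_eq_card_ker Θ hΘ, nsmul_eq_mul,
      mul_inv_cancel₀ (card_ker_ne_zero Θ)]
  · refine Finset.sum_eq_zero fun y _ => ?_
    split_ifs with h1 h2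
    · exact absurd (by rw [h1] at h2; simp at h2; exact Prod.ext h2.2.symm h2.1.symm) h
    all_goals rfl

lemma encodedState_cssEncoder (Θ : (Fin n → F) →ₗ[F] M × (Fin c → F) × (Fin k → F))
    (x : Fin k → F) (y : Fin n → F) (z : Fin c → F) :
    encodedState (cssEncoder Θ) x (y, z) = if Θ y = (0, z, x) then
      ((Real.sqrt (Finset.univ.filter fun y => Θ y = 0).card : ℝ) : ℂ)⁻¹ *
      ((Real.sqrt ((Fintype.card F ^ c : ℕ) : ℝ) : ℝ) : ℂ)⁻¹ else 0 := by
  simp only [encodedState, cssEncoder, div_eq_mul_inv, ite_mul, zero_mul]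
  push_cast
  rfl

/-- Matrix elements of an error between encoded basis states. -/
lemma encodedState_matrixElement (Θ : (Fin n → F) →ₗ[F] M × (Fin c → F) × (Fin k → F))
    (E : Matrix (Fin n → F) (Fin n → F) ℂ) (x x' : Fin k → F) :
    star (encodedState (cssEncoder Θ) x) ⬝ᵥ
        ((E ⊗ₖ (1 : Matrix (Fin c → F) (Fin c → F) ℂ)) *ᵥ encodedState (cssEncoder Θ) x') =
      ((Finset.univ.filter fun y => Θ y = 0).card * Fintype.card F ^ c : ℂ)⁻¹ *
        ∑ y, ∑ y', if (Θ y).1 = 0 ∧ (Θ y).2.2 = x ∧ (Θ y').1 = 0 ∧ (Θ y').2.2 = x' ∧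
          (Θ y).2.1 = (Θ y').2.1 then E y y' else 0 := by
  have key : ∀ y y' : Fin n → F, ∑ z, star (encodedState (cssEncoder Θ) x (y, z)) *
      (E y y' * encodedState (cssEncoder Θ) x' (y', z)) =
      ((Finset.univ.filter fun y => Θ y = 0).card * Fintype.card F ^ c : ℂ)⁻¹ *
      if (Θ y).1 = 0 ∧ (Θ y).2.2 = x ∧ (Θ y').1 = 0 ∧ (Θ y').2.2 = x' ∧
          (Θ y).2.1 = (Θ y').2.1 then E y y' else 0 := by
    intro y y'
    rw [Finset.sum_eq_single (Θ y).2.1]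
    · rw [encodedState_cssEncoder, encodedState_cssEncoder]
      by_cases h : (Θ y).1 = 0 ∧ (Θ y).2.2 = x ∧ (Θ y').1 = 0 ∧ (Θ y').2.2 = x' ∧
          (Θ y).2.1 = (Θ y').2.1
      · obtain ⟨h1, h2, h3, h4, h5⟩ := h
        have e1 := inv_sqrt_mul_inv_sqrt (Finset.univ.filter fun y => Θ y = 0).card
        have e2 := inv_sqrt_mul_inv_sqrt (Fintype.card F ^ c)
        have hy : Θ y = (0, (Θ y).2.1, x) := Prod.ext h1 (Prod.ext rfl h2)
        have hy' : Θ y' = (0, (Θ y).2.1, x') := Prod.ext h3 (Prod.ext h5.symm h4)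
        rw [if_pos hy, if_pos hy', if_pos (⟨h1, h2, h3, h4, h5⟩ : _ ∧ _)]
        simp only [star_mul', star_inv₀, Complex.star_def, Complex.conj_ofReal]
        rw [mul_inv, ← e1, ← Nat.cast_pow, ← e2]
        ring
      · rw [if_neg h, mul_zero]
        split_ifs with h1 h2
        · rw [h1, h2] at h
          exact absurd ⟨rfl, rfl, rfl, rfl, rfl⟩ h
        all_goals simp
    · intro z _ hz
      rw [encodedState_cssEncoder, if_neg, star_zero, zero_mul]
      intro h
      rw [h] at hz
      exact hz rfl
    · simp
  rw [Finset.mul_sum]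
  simp_rw [Finset.mul_sum, ← key]
  simp only [dotProduct, Matrix.mulVec, Fintype.sum_prod_type, Matrix.kroneckerMap_apply,
    Matrix.one_apply, Pi.star_apply, mul_ite, mul_one, mul_zero, ite_mul, zero_mul,
    Finset.sum_ite_eq, Finset.mem_univ, if_true, Finset.mul_sum]
  exact Finset.sum_congr rfl fun y _ => Finset.sum_comm

lemma card_logical_fiber (Θ : (Fin n → F) →ₗ[F] M × (Fin c → F) × (Fin k → F))
    (hΘ : Function.Surjective Θ) (x : Fin k → F) :
    (Finset.univ.filter fun y => (Θ y).1 = 0 ∧ (Θ y).2.2 = x).card =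
      (Finset.univ.filter fun y => Θ y = 0).card * Fintype.card F ^ c := by
  rw [Finset.card_eq_sum_card_fiberwise (f := fun y => (Θ y).2.1) (t := Finset.univ) (by simp)]
  rw [Finset.sum_congr rfl fun z _ => (?_ : _ = (Finset.univ.filter fun y => Θ y = 0).card)]
  · simp [mul_comm]
  · rw [← card_fiber_eq_card_ker Θ hΘ (0, z, x), Finset.filter_filter]
    congr 1
    ext y
    simp [Prod.ext_iff]
    tauto

/-- A CSS code detects all errors on `S` if no nonzero vector supported in `S` commutes with the
phase stabilisers and if the shift stabilisers restrict onto `S`. -/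
lemma cssEncoder_detects (Θ : (Fin n → F) →ₗ[F] M × (Fin c → F) × (Fin k → F))
    (hΘ : Function.Surjective Θ) (S : Finset (Fin n))
    (hS : ∀ w, (∀ i ∉ S, w i = 0) → (Θ w).1 = 0 → (Θ w).2.1 = 0 → w = 0)
    (hlift : ∀ t : Fin n → F, ∃ a, (Θ a).1 = 0 ∧ (Θ a).2.2 = 0 ∧ ∀ i ∈ S, a i = t i)
    (E : Matrix (Fin n → F) (Fin n → F) ℂ) (hE : ActsOn S E) : Detects (cssEncoder Θ) E := by
  obtain ⟨m, hm⟩ := hE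
  refine ⟨E.trace / (Fintype.card F : ℂ) ^ n, fun x x' => ?_, fun _ => rfl⟩
  rw [encodedState_matrixElement]
  -- A nonzero contribution needs `y - y'` supported in `S` with vanishing gauge and entanglement
  -- coordinates, so `hS` leaves only the diagonal.
  have hdiag : ∀ y y' : Fin n → F, (if (Θ y).1 = 0 ∧ (Θ y).2.2 = x ∧ (Θ y').1 = 0 ∧
      (Θ y').2.2 = x' ∧ (Θ y).2.1 = (Θ y').2.1 then E y y' else 0) =
      if y = y' then (if (Θ y).1 = 0 ∧ (Θ y).2.2 = x ∧ x = x' then E y y else 0) else 0 := by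
    intro y y'
    by_cases hyy : y = y'
    · subst hyy
      by_cases hx : (Θ y).2.2 = x
      · subst hx; simp
      · simp [hx]
    · rw [if_neg hyy]
      split_ifs with h
      · rw [hm, if_neg]
        intro h'
        refine hyy (sub_eq_zero.mp (hS (y - y') (fun i hi => ?_) ?_ ?_))
        · simp [h' i hi]
        · simp [h.1, h.2.2.1]
        · simp [h.2.2.2.2]
      · rfl
  simp only [hdiag, Finset.sum_ite_eq, Finset.mem_univ, if_true]
  by_cases hx : x = x'
  swap
  · simp [hx]
  simp only [hx, and_true, if_true]
  rw [← Finset.sum_filter]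
  set G := Finset.univ.filter fun y => (Θ y).1 = 0 ∧ (Θ y).2.2 = x' with hG
  have hcard : (G.card : ℂ) = (Finset.univ.filter fun y => Θ y = 0).card * Fintype.card F ^ c := by
    exact_mod_cast card_logical_fiber Θ hΘ x'
  -- Diagonal entries of `E` depend only on the coordinates in `S`, so `t` may be replaced by a
  -- shift `a` that agrees with it on `S` and permutes `G`.
  have htrans : ∀ t : Fin n → F, ∑ y ∈ G, E (y + t) (y + t) = ∑ y ∈ G, E y y := by
    intro t
    obtain ⟨a, ha1, ha2, ha3⟩ := hlift t
    have : ∀ y, E (y + t) (y + t) = E (y + a) (y + a) := by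
      intro y
      rw [hm, hm, if_pos (fun _ _ => rfl), if_pos (fun _ _ => rfl)]
      have : (fun i : S => (y + t) i) = fun i : S => (y + a) i := by
        ext i; simp [ha3 i i.2]
      rw [this]
    simp_rw [this]
    refine Finset.sum_bij' (fun y _ => y + a) (fun y _ => y - a) ?_ ?_ ?_ ?_ ?_ <;>
      simp +contextual [hG, ha1, ha2]
  -- Averaging over all `t` turns the sum over `G` into the full trace, so the scalar does not
  -- depend on the logical state.
  have hsum : (G.card : ℂ) * E.trace = (Fintype.card F : ℂ) ^ n * ∑ y ∈ G, E y y := by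
    calc (G.card : ℂ) * E.trace = ∑ y ∈ G, ∑ t, E (y + t) (y + t) := by
          have : ∀ y, ∑ t, E (y + t) (y + t) = E.trace := fun y =>
            Equiv.sum_comp (Equiv.addLeft y) fun t => E t t
          simp [this]
      _ = ∑ t, ∑ y ∈ G, E (y + t) (y + t) := Finset.sum_comm
      _ = _ := by simp [htrans]
  have hq : (Fintype.card F : ℂ) ≠ 0 := by simp
  have hN := card_ker_ne_zero Θ
  rw [← hcard, inv_mul_eq_div, div_eq_div_iff (by rw [hcard]; positivity) (by positivity)]
  linear_combination -hsum

/-- A shift by a vector that commutes with all phase stabilisers and acts nontrivially on the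
logical qudits (if there are any) is not detected. -/
lemma cssEncoder_not_detects_shift (Θ : (Fin n → F) →ₗ[F] M × (Fin c → F) × (Fin k → F))
    (hΘ : Function.Surjective Θ) (S : Finset (Fin n)) (w : Fin n → F) (hw : w ≠ 0)
    (hwS : ∀ i ∉ S, w i = 0) (h1 : (Θ w).1 = 0) (h2 : (Θ w).2.1 = 0)
    (h3 : k ≠ 0 → (Θ w).2.2 ≠ 0) : ∃ E, ActsOn S E ∧ ¬ Detects (cssEncoder Θ) E := by
  refine ⟨Matrix.of fun y y' => if y = y' + w then 1 else 0,
    ⟨Matrix.of fun y y' => if ∀ i, y i = y' i + w i then 1 else 0, fun y y' => ?_⟩, ?_⟩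
  · simp only [Matrix.of_apply]
    rw [← ite_and]
    congr 1
    rw [eq_iff_iff, funext_iff]
    constructor
    · exact fun h => ⟨fun i hi => by simp [h i, hwS i hi], fun i => h i⟩
    · intro h i
      by_cases hi : i ∈ S
      · exact h.2 ⟨i, hi⟩
      · simp [h.1 i hi, hwS i hi]
  · rintro ⟨lam, hl, hk⟩
    -- The shift maps the encoded `0` to the encoded `(Θ w).2.2`, so this matrix element is `1`. It
    -- is off-diagonal for `k ≠ 0`; for `k = 0` it contradicts the trace `0` of a nontrivial shift.
    have hl := hl (Θ w).2.2 0
    rw [encodedState_matrixElement] at hl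
    have hsum : (∑ y, ∑ y', if (Θ y).1 = 0 ∧ (Θ y).2.2 = (Θ w).2.2 ∧ (Θ y').1 = 0 ∧
        (Θ y').2.2 = 0 ∧ (Θ y).2.1 = (Θ y').2.1 then
        (Matrix.of fun y y' : Fin n → F => if y = y' + w then (1 : ℂ) else 0) y y' else 0) =
        ((Finset.univ.filter fun y => (Θ y).1 = 0 ∧ (Θ y).2.2 = 0).card : ℂ) := by
      rw [Finset.sum_comm, Finset.card_filter, Nat.cast_sum]
      refine Finset.sum_congr rfl fun y' _ => ?_
      rw [Finset.sum_eq_single (y' + w)]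
      · simp only [map_add, Prod.fst_add, Prod.snd_add, h1, h2, add_zero, add_eq_right,
          Matrix.of_apply, if_true, Nat.cast_ite, Nat.cast_one, Nat.cast_zero]
        exact if_congr (by tauto) rfl rfl
      · intro y _ hy
        simp [hy]
      · simp
    rw [hsum, card_logical_fiber Θ hΘ] at hl
    have hN := card_ker_ne_zero Θ
    have hq : (Fintype.card F : ℂ) ≠ 0 := by simp
    push_cast at hl
    rw [inv_mul_cancel₀ (by positivity)] at hl
    by_cases hk0 : k = 0
    · have : lam = 0 := by
        rw [hk hk0]
        simp [Matrix.trace, hw]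
      simp [this] at hl
    · simp [h3 hk0] at hl

/-- A function of a linear functional `w` that is constant on the logical cosets is not detected
if it distinguishes two of these. -/
lemma cssEncoder_not_detects_phase (Θ : (Fin n → F) →ₗ[F] M × (Fin c → F) × (Fin k → F))
    (hΘ : Function.Surjective Θ) (S : Finset (Fin n)) (w : Fin n → F) (hw : w ≠ 0)
    (hwS : ∀ i ∉ S, w i = 0) (h1 : ∀ y, (Θ y).1 = 0 → (Θ y).2.2 = 0 → w ⬝ᵥ y = 0)
    (h2 : k ≠ 0 → ∃ y, (Θ y).1 = 0 ∧ w ⬝ᵥ y ≠ 0) :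
    ∃ E, ActsOn S E ∧ ¬ Detects (cssEncoder Θ) E := by
  have hdot : ∀ y : Fin n → F, w ⬝ᵥ y = ∑ i : S, w i * y i := by
    intro y
    rw [Finset.sum_coe_sort S fun i => w i * y i]
    exact (Finset.sum_subset (Finset.subset_univ S) fun i _ hi => by simp [hwS i hi]).symm
  -- The projector onto the hyperplane `w ⬝ᵥ y = 0` replaces the phase `Z(w)`, so no nontrivial
  -- character has to be chosen.
  refine ⟨Matrix.diagonal fun y => if w ⬝ᵥ y = 0 then 1 else 0,
    ⟨Matrix.diagonal fun y => if ∑ i : S, w i * y i = 0 then 1 else 0, fun y y' => ?_⟩, ?_⟩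
  · simp only [Matrix.diagonal_apply, hdot]
    by_cases h : y = y'
    · simp [h]
    · rw [if_neg h, ← ite_and, if_neg]
      rintro ⟨ha, hb⟩
      refine h (funext fun i => ?_)
      by_cases hi : i ∈ S
      · exact congrFun hb ⟨i, hi⟩
      · exact ha i hi
  · rintro ⟨lam, hl, hk⟩
    have hN := card_ker_ne_zero Θ
    have hq : (Fintype.card F : ℂ) ≠ 0 := by simp
    have hval : ∀ y₀, (Θ y₀).1 = 0 → (if w ⬝ᵥ y₀ = 0 then 1 else 0) = lam := by
      intro y₀ hy₀
      have hl := hl (Θ y₀).2.2 (Θ y₀).2.2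
      rw [encodedState_matrixElement, if_pos rfl] at hl
      have hsum : (∑ y, ∑ y', if (Θ y).1 = 0 ∧ (Θ y).2.2 = (Θ y₀).2.2 ∧ (Θ y').1 = 0 ∧
          (Θ y').2.2 = (Θ y₀).2.2 ∧ (Θ y).2.1 = (Θ y').2.1 then
          (Matrix.diagonal fun y : Fin n → F => if w ⬝ᵥ y = 0 then (1 : ℂ) else 0) y y' else 0) =
          ((Finset.univ.filter fun y => (Θ y).1 = 0 ∧ (Θ y).2.2 = (Θ y₀).2.2).card : ℂ) *
            if w ⬝ᵥ y₀ = 0 then 1 else 0 := by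
        rw [Finset.card_filter, Nat.cast_sum, Finset.sum_mul]
        refine Finset.sum_congr rfl fun y _ => ?_
        rw [Finset.sum_eq_single y]
        · by_cases h : (Θ y).1 = 0 ∧ (Θ y).2.2 = (Θ y₀).2.2
          · have : w ⬝ᵥ y = w ⬝ᵥ y₀ := by
              rw [← sub_eq_zero, ← dotProduct_sub]
              exact h1 _ (by simp [h.1, hy₀]) (by simp [h.2])
            simp [h, this]
          · rw [if_neg (by tauto), if_neg h]; simp
        · intro y' _ hy
          simp [Matrix.diagonal_apply_ne' _ hy]
        · simp
      rw [hsum, card_logical_fiber Θ hΘ] at hl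
      push_cast at hl
      rwa [inv_mul_cancel_left₀ (by positivity)] at hl
    have hlam : lam = 1 := by
      rw [← hval 0 (by simp)]; simp
    by_cases hk0 : k = 0
    -- For `k = 0` the scalar `1` would have to be the normalised trace, but a hyperplane is a
    -- proper subset of `F^n`.
    · have := hk hk0
      rw [hlam, eq_div_iff (by positivity), one_mul, Matrix.trace_diagonal] at this
      have hlt : (Finset.univ.filter fun y => w ⬝ᵥ y = 0).card < Fintype.card (Fin n → F) := by
        obtain ⟨i, hi⟩ := Function.ne_iff.mp hw
        refine Finset.card_lt_univ_of_notMem (x := Pi.single i 1) ?_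
        simpa using hi
      rw [Finset.sum_boole] at this
      norm_cast at this
      rw [← this] at hlt
      simp at hlt
    · obtain ⟨y, hy1, hy2⟩ := h2 hk0
      have := hval y hy1
      simp [hlam, hy2] at this

lemma cssEncoder_isEuclideanConstruction
    (Θ : (Fin n → F) →ₗ[F] M × (Fin c → F) × (Fin k → F)) (C₁ C₂ : Submodule F (Fin n → F))
    (h1 : ∀ a ∈ euclideanDual C₁, (Θ a).1 = 0 ∧ (Θ a).2.2 = 0)
    (h2 : ∀ b ∈ euclideanDual C₂, ∃ v : Fin c → F, ∀ y, (Θ y).1 = 0 →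
      b ⬝ᵥ y + v ⬝ᵥ (Θ y).2.1 = 0) :
    IsEuclideanConstruction C₁ C₂ (cssEncoder Θ) where
  shift a ha := by
    obtain ⟨ha1, ha2⟩ := h1 a ha
    refine ⟨(Θ a).2.1, fun x y z => ?_⟩
    simp [encodedState_cssEncoder, Prod.ext_iff, ha1, ha2]
  phase b hb := by
    obtain ⟨v, hv⟩ := h2 b hb
    refine ⟨v, fun χ x y z => ?_⟩
    rw [encodedState_cssEncoder]
    split_ifs with h
    · have := hv y (by rw [h])
      rw [h] at this
      rw [this, AddChar.map_zero_eq_one, one_mul]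
    · rw [mul_zero]

end CSS

/-! ### Entanglement-assisted codes from a pair of biorthogonal bases. -/

section Biorthogonal

variable {F : Type*} [Field F] {n : ℕ}

/-- Biorthogonality is a one-sided inverse relation between square matrices, hence two-sided. -/
lemma sum_smul_of_biorthogonal {e f : Fin n → Fin n → F}
    (hfe : ∀ s t, f s ⬝ᵥ e t = if s = t then 1 else 0) (y : Fin n → F) :
    y = ∑ s, (f s ⬝ᵥ y) • e s := by
  have h : (Matrix.of f) * (Matrix.of e)ᵀ = 1 := by
    ext s t
    rw [Matrix.one_apply, ← hfe, Matrix.mul_apply']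
    rfl
  have h' : (Matrix.of e)ᵀ *ᵥ (Matrix.of f *ᵥ y) = y := by
    rw [Matrix.mulVec_mulVec, mul_eq_one_comm.mp h, Matrix.one_mulVec]
  conv_lhs => rw [← h']
  ext j
  simp [Matrix.mulVec, dotProduct, mul_comm]

lemma dotProduct_eq_sum_of_biorthogonal {e f : Fin n → Fin n → F}
    (hfe : ∀ s t, f s ⬝ᵥ e t = if s = t then 1 else 0) (b y : Fin n → F) :
    b ⬝ᵥ y = ∑ s, (f s ⬝ᵥ y) * (b ⬝ᵥ e s) := by
  conv_lhs => rw [sum_smul_of_biorthogonal hfe y]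
  simp [dotProduct_sum]

/-- The coordinates `f s ⬝ᵥ y`, sorted into gauge, entanglement and logical coordinates. -/
def coordMap {k c : ℕ} {A B : Finset (Fin n)} (f : Fin n → Fin n → F)
    (ι : Fin c ≃ ↥(A ∩ B)) (κ : Fin k ≃ ↥(A ∪ B)ᶜ) :
    (Fin n → F) →ₗ[F] (↥(B \ A) → F) × (Fin c → F) × (Fin k → F) where
  toFun y := (fun s => f s ⬝ᵥ y, fun i => f (ι i) ⬝ᵥ y, fun i => f (κ i) ⬝ᵥ y)
  map_add' y y' := by simp only [dotProduct_add]; rfl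
  map_smul' r y := by simp only [dotProduct_smul]; rfl

lemma coordMap_surjective {k c : ℕ} {A B : Finset (Fin n)} {e f : Fin n → Fin n → F}
    (hfe : ∀ s t, f s ⬝ᵥ e t = if s = t then 1 else 0)
    (ι : Fin c ≃ ↥(A ∩ B)) (κ : Fin k ≃ ↥(A ∪ B)ᶜ) :
    Function.Surjective (coordMap f ι κ) := by
  rintro ⟨h, z, x⟩
  let g : Fin n → F := fun s =>
    if hs : s ∈ B \ A then h ⟨s, hs⟩
    else if hs : s ∈ A ∩ B then z (ι.symm ⟨s, hs⟩)
    else if hs : s ∈ (A ∪ B)ᶜ then x (κ.symm ⟨s, hs⟩) else 0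
  have hg : ∀ s, f s ⬝ᵥ (∑ t, g t • e t) = g s := by
    intro s
    simp [dotProduct_sum, hfe]
  refine ⟨∑ t, g t • e t, ?_⟩
  simp only [coordMap, LinearMap.coe_mk, AddHom.coe_mk, hg]
  refine Prod.ext (funext fun s => ?_) (Prod.ext (funext fun i => ?_) (funext fun i => ?_))
  · simp only [g, dif_pos s.2]
  · have hi := (ι i).2
    have hi' : (ι i : Fin n) ∉ B \ A := by
      simp only [Finset.mem_inter] at hi
      simp [hi.1]
    simp only [g, dif_neg hi', dif_pos hi, Subtype.coe_eta, Equiv.symm_apply_apply]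
  · have hi := (κ i).2
    have hi' : (κ i : Fin n) ∉ B \ A ∧ (κ i : Fin n) ∉ A ∩ B := by
      simp only [Finset.mem_compl, Finset.mem_union, not_or] at hi
      simp [hi.1, hi.2]
    simp only [g, dif_neg hi'.1, dif_neg hi'.2, dif_pos hi, Subtype.coe_eta,
      Equiv.symm_apply_apply]

section coordMap

variable {k c : ℕ} {A B : Finset (Fin n)} {f : Fin n → Fin n → F}
    {ι : Fin c ≃ ↥(A ∩ B)} {κ : Fin k ≃ ↥(A ∪ B)ᶜ} {y : Fin n → F}

lemma coordMap_gauge_eq_zero_iff :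
    (coordMap f ι κ y).1 = 0 ↔ ∀ s ∈ B, s ∉ A → f s ⬝ᵥ y = 0 := by
  simp only [coordMap, LinearMap.coe_mk, AddHom.coe_mk, funext_iff, Pi.zero_apply,
    Subtype.forall, Finset.mem_sdiff, and_imp]

lemma coordMap_ebit_eq_zero_iff :
    (coordMap f ι κ y).2.1 = 0 ↔ ∀ s ∈ A, s ∈ B → f s ⬝ᵥ y = 0 := by
  simp only [coordMap, LinearMap.coe_mk, AddHom.coe_mk, funext_iff, Pi.zero_apply]
  rw [ι.forall_congr_left]
  simp

lemma coordMap_logical_eq_zero_iff :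
    (coordMap f ι κ y).2.2 = 0 ↔ ∀ s ∉ A, s ∉ B → f s ⬝ᵥ y = 0 := by
  simp only [coordMap, LinearMap.coe_mk, AddHom.coe_mk, funext_iff, Pi.zero_apply]
  rw [κ.forall_congr_left]
  simp

end coordMap

/-- If `C₁` and `C₂` are described by sets `A` and `B` of vanishing coordinates with respect to
biorthogonal bases, then they give a code with `|A ∩ B|` maximally entangled pairs. -/
theorem givesQuentaCode_of_biorthogonal [Fintype F] [DecidableEq F] {k d c : ℕ}
    {e f : Fin n → Fin n → F}
    (hfe : ∀ s t, f s ⬝ᵥ e t = if s = t then 1 else 0) {A B : Finset (Fin n)}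
    {C₁ C₂ : Submodule F (Fin n → F)}
    (hC₁ : ∀ v, v ∈ C₁ ↔ ∀ s ∈ A, e s ⬝ᵥ v = 0) (hC₂ : ∀ v, v ∈ C₂ ↔ ∀ s ∈ B, f s ⬝ᵥ v = 0)
    (hc : (A ∩ B).card = c) (hk : (A ∪ B)ᶜ.card = k)
    (hlift : ∀ S : Finset (Fin n), S.card < d → ∀ t : Fin n → F,
      ∃ a, (∀ s ∉ A, f s ⬝ᵥ a = 0) ∧ ∀ i ∈ S, a i = t i)
    (hdist : ∀ S : Finset (Fin n), S.card < d → ∀ w ∈ C₂, (∀ i ∉ S, w i = 0) → w = 0)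
    (hnot : ∃ S : Finset (Fin n), S.card = d ∧ ∃ w, w ≠ 0 ∧ (∀ i ∉ S, w i = 0) ∧
      ((w ∈ C₂ ∧ ∀ s ∉ A, s ∉ B → f s ⬝ᵥ w ≠ 0) ∨ (w ∈ C₁ ∧ ∀ s ∉ A, s ∉ B → e s ⬝ᵥ w ≠ 0))) :
    GivesQuentaCode C₁ C₂ k d c := by
  let ι : Fin c ≃ ↥(A ∩ B) := (Finset.equivFinOfCardEq hc).symm
  let κ : Fin k ≃ ↥(A ∪ B)ᶜ := (Finset.equivFinOfCardEq hk).symm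
  have hκ : ∀ i, (κ i : Fin n) ∉ A ∧ (κ i : Fin n) ∉ B := fun i => by
    have := (κ i).2
    simpa only [Finset.mem_compl, Finset.mem_union, not_or] using this
  have hΘ := coordMap_surjective hfe ι κ
  refine ⟨cssEncoder (coordMap f ι κ), ⟨cssEncoder_isometry _ hΘ, fun S E hS hE => ?_, ?_⟩, ?_⟩
  · refine cssEncoder_detects _ hΘ S (fun w hw h1 h2 => ?_) (fun t => ?_) E hE
    · rw [coordMap_gauge_eq_zero_iff] at h1
      rw [coordMap_ebit_eq_zero_iff] at h2
      refine hdist S hS w ((hC₂ w).mpr fun s hs => ?_) hw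
      by_cases hsA : s ∈ A
      · exact h2 s hsA hs
      · exact h1 s hs hsA
    · obtain ⟨a, ha, hat⟩ := hlift S hS t
      exact ⟨a, coordMap_gauge_eq_zero_iff.mpr fun s _ hs => ha s hs,
        coordMap_logical_eq_zero_iff.mpr fun s hs _ => ha s hs, hat⟩
  · obtain ⟨S, hS, w, hw, hwS, h⟩ := hnot
    refine ⟨S, ?_⟩
    simp only [hS, true_and]
    rcases h with ⟨hwC, hwf⟩ | ⟨hwC, hwe⟩
    · rw [hC₂] at hwC
      refine cssEncoder_not_detects_shift _ hΘ S w hw hwS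
        (coordMap_gauge_eq_zero_iff.mpr fun s hs _ => hwC s hs)
        (coordMap_ebit_eq_zero_iff.mpr fun s _ hs => hwC s hs) fun hk0 h => ?_
      let i : Fin k := ⟨0, Nat.pos_of_ne_zero hk0⟩
      rw [coordMap_logical_eq_zero_iff] at h
      exact hwf _ (hκ i).1 (hκ i).2 (h _ (hκ i).1 (hκ i).2)
    · rw [hC₁] at hwC
      refine cssEncoder_not_detects_phase _ hΘ S w hw hwS (fun y h1 h2 => ?_) fun hk0 => ?_
      · rw [coordMap_gauge_eq_zero_iff] at h1
        rw [coordMap_logical_eq_zero_iff] at h2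
        rw [dotProduct_eq_sum_of_biorthogonal hfe]
        refine Finset.sum_eq_zero fun s _ => ?_
        by_cases hsA : s ∈ A
        · rw [dotProduct_comm w, hwC s hsA, mul_zero]
        · by_cases hsB : s ∈ B
          · rw [h1 s hsB hsA, zero_mul]
          · rw [h2 s hsA hsB, zero_mul]
      · let i : Fin k := ⟨0, Nat.pos_of_ne_zero hk0⟩
        refine ⟨e (κ i), coordMap_gauge_eq_zero_iff.mpr fun s hs _ => ?_, ?_⟩
        · rw [hfe, if_neg]
          rintro rfl
          exact (hκ i).2 hs
        · rw [dotProduct_comm]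
          exact hwe _ (hκ i).1 (hκ i).2
  · refine cssEncoder_isEuclideanConstruction _ _ _ (fun a ha => ?_) fun b hb => ?_
    · have h : ∀ s ∉ A, f s ⬝ᵥ a = 0 := fun s hs => by
        rw [dotProduct_comm]
        refine ha _ ((hC₁ _).mpr fun t ht => ?_)
        rw [dotProduct_comm, hfe, if_neg]
        rintro rfl
        exact hs ht
      exact ⟨coordMap_gauge_eq_zero_iff.mpr fun s _ hs => h s hs,
        coordMap_logical_eq_zero_iff.mpr fun s hs _ => h s hs⟩
    -- In the expansion of `b ⬝ᵥ y`, terms outside `B` vanish because `b ∈ C₂^⊥`, and terms in `B \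
    -- A` because `y` has zero gauge coordinates. The receiver cancels the rest, which lives on `A ∩
    -- B`.
    · refine ⟨fun i => -(b ⬝ᵥ e (ι i)), fun y hy => ?_⟩
      rw [coordMap_gauge_eq_zero_iff] at hy
      have hbe : ∀ s ∉ B, b ⬝ᵥ e s = 0 := fun s hs => by
        refine hb _ ((hC₂ _).mpr fun t ht => ?_)
        rw [hfe, if_neg]
        rintro rfl
        exact hs ht
      have hsum : ∑ i, (f (ι i) ⬝ᵥ y) * (b ⬝ᵥ e (ι i)) = b ⬝ᵥ y := by
        rw [Equiv.sum_comp ι fun s => (f s ⬝ᵥ y) * (b ⬝ᵥ e s),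
          Finset.sum_coe_sort (A ∩ B) fun s => (f s ⬝ᵥ y) * (b ⬝ᵥ e s),
          dotProduct_eq_sum_of_biorthogonal hfe]
        refine Finset.sum_subset (Finset.subset_univ _) fun s _ hs => ?_
        by_cases hsB : s ∈ B
        · rw [hy s hsB fun hsA => hs (Finset.mem_inter.mpr ⟨hsA, hsB⟩), zero_mul]
        · rw [hbe s hsB, mul_zero]
      rw [← hsum]
      simp [coordMap, dotProduct, mul_comm]

end Biorthogonal

/-! ### Reed-Solomon codes in the Fourier basis. -/

section ReedSolomon

open Polynomial

variable {F : Type*} [Field F] {n : ℕ}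

/-- The vector of values of the monomial `X ^ s` at the powers of `β`. -/
def freqVec (n : ℕ) (β : F) (s : ℕ) : Fin n → F := fun j => (β ^ s) ^ (j : ℕ)

lemma eval_wordPoly (β : F) (s : ℕ) (v : Fin n → F) :
    (wordPoly v).eval (β ^ s) = freqVec n β s ⬝ᵥ v := by
  simp only [wordPoly, eval_finsetSum, eval_mul, eval_C, eval_pow, eval_X, dotProduct, freqVec]
  exact Finset.sum_congr rfl fun i _ => mul_comm _ _

lemma eval_rsGenerator (α β : F) (k b : ℕ) :
    (rsGenerator α n k b).eval β = ∏ i ∈ Finset.range (n - k), (β - α ^ (b + i)) := by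
  simp [rsGenerator, eval_prod]

/-- The roots of the generator are distinct powers of `α`, so its linear factors are pairwise
coprime and divisibility can be tested root by root. -/
lemma mem_reedSolomon_iff {α : F} (hα : IsPrimitiveRoot α n) {k : ℕ} (hk : 1 ≤ k) (hkn : k ≤ n)
    (b : ℕ) (v : Fin n → F) :
    v ∈ reedSolomon α n k b ↔ ∀ i < n - k, freqVec n α (b + i) ⬝ᵥ v = 0 := by
  change rsGenerator α n k b ∣ wordPoly v ↔ _
  simp_rw [← eval_wordPoly, ← IsRoot.def, ← dvd_iff_isRoot]
  constructor
  · intro h i hi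
    exact (Finset.dvd_prod_of_mem (fun i => X - C (α ^ (b + i))) (Finset.mem_range.mpr hi)).trans h
  · intro h
    refine Finset.prod_dvd_of_coprime (fun i hi j hj hij => ?_)
      fun i hi => h i (Finset.mem_range.mp hi)
    refine isCoprime_X_sub_C_of_isUnit_sub (sub_ne_zero.mpr fun h => hij ?_).isUnit
    simp only [Finset.coe_range, Set.mem_Iio] at hi hj
    rw [pow_add, pow_add] at h
    exact hα.pow_inj (by omega) (by omega)
      (mul_left_cancel₀ (pow_ne_zero _ (hα.ne_zero (by omega))) h)

/-- The code word whose polynomial is the generator polynomial. -/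
noncomputable def generatorWord (α : F) (n k b : ℕ) : Fin n → F :=
  fun j => (rsGenerator α n k b).coeff j

lemma natDegree_rsGenerator (α : F) (k b : ℕ) : (rsGenerator α n k b).natDegree = n - k := by
  rw [rsGenerator, natDegree_prod_of_monic _ _ fun i _ => monic_X_sub_C (α ^ (b + i))]
  simp only [natDegree_X_sub_C, Finset.sum_const, Finset.card_range, smul_eq_mul, mul_one]

lemma wordPoly_generatorWord (α : F) {k : ℕ} (hk : 1 ≤ k) (hkn : k ≤ n) (b : ℕ) :
    wordPoly (generatorWord α n k b) = rsGenerator α n k b := by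
  rw [(rsGenerator α n k b).as_sum_range_C_mul_X_pow' (n := n)
    (by rw [natDegree_rsGenerator]; omega), wordPoly, Finset.sum_range]
  rfl

lemma generatorWord_mem (α : F) {k : ℕ} (hk : 1 ≤ k) (hkn : k ≤ n) (b : ℕ) :
    generatorWord α n k b ∈ reedSolomon α n k b := by
  change rsGenerator α n k b ∣ wordPoly _
  rw [wordPoly_generatorWord α hk hkn]

lemma generatorWord_ne_zero (α : F) {k : ℕ} (hk : 1 ≤ k) (hkn : k ≤ n) (b : ℕ) :
    generatorWord α n k b ≠ 0 := by
  intro h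
  have h1 := wordPoly_generatorWord α hk hkn b
  rw [h] at h1
  refine (monic_prod_of_monic _ _ fun i _ => monic_X_sub_C (α ^ (b + i))).ne_zero (h1.symm.trans ?_)
  simp [wordPoly]

lemma generatorWord_apply_eq_zero (α : F) (k b : ℕ) (j : Fin n) (hj : n - k < j) :
    generatorWord α n k b j = 0 :=
  coeff_eq_zero_of_natDegree_lt (by rwa [natDegree_rsGenerator])

lemma freqVec_dotProduct_generatorWord (α β : F) {k : ℕ} (hk : 1 ≤ k) (hkn : k ≤ n) (b s : ℕ) :
    freqVec n β s ⬝ᵥ generatorWord α n k b =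
      ∏ i ∈ Finset.range (n - k), (β ^ s - α ^ (b + i)) := by
  rw [← eval_wordPoly, wordPoly_generatorWord α hk hkn, eval_rsGenerator]

/-- Words on at most `m` positions extend to combinations of `m` consecutive frequencies. -/
lemma exists_sum_freqVec_eqOn {α : F} (hα : IsPrimitiveRoot α n) (b : ℕ) {m : ℕ}
    (S : Finset (Fin n)) (hS : S.card ≤ m) (t : Fin n → F) :
    ∃ p : ℕ → F, ∀ j ∈ S, (∑ i ∈ Finset.range m, p i • freqVec n α (b + i)) j = t j := by
  classical
  -- Dividing by `(α ^ b) ^ j` moves the frequencies `b, …, b + m - 1` to `0, …, m - 1`, that is, to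
  -- polynomials of degree less than `m` at the distinct nodes `α ^ j`.
  let P := Lagrange.interpolate S (fun j : Fin n => α ^ (j : ℕ)) fun j => t j / (α ^ b) ^ (j : ℕ)
  have hinj : Set.InjOn (fun j : Fin n => α ^ (j : ℕ)) S := fun i _ j _ h =>
    Fin.ext (hα.pow_inj i.2 j.2 h)
  refine ⟨P.coeff, fun j hj => ?_⟩
  have hP := Lagrange.eval_interpolate_at_node (fun j : Fin n => t j / (α ^ b) ^ (j : ℕ)) hinj hj
  have hα0 : α ≠ 0 := hα.ne_zero (by have := j.2; omega)
  rw [eq_div_iff (by positivity)] at hP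
  rw [← hP]
  by_cases hm : m = 0
  · subst hm; simp_all
  rw [eval_eq_sum_range' (n := m), Finset.sum_mul]
  · simp only [Finset.sum_apply, Pi.smul_apply, smul_eq_mul, freqVec]
    refine Finset.sum_congr rfl fun i _ => ?_
    change P.coeff i * _ = P.coeff i * _ * _
    ring
  · have h := Lagrange.degree_interpolate_lt (fun j : Fin n => t j / (α ^ b) ^ (j : ℕ)) hinj
    by_cases hP0 : P = 0
    · exact (congrArg natDegree hP0).trans_lt (by rw [natDegree_zero]; omega)
    · exact (natDegree_lt_iff_degree_lt hP0).mpr (h.trans_le (by exact_mod_cast hS))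

/-- The pairing is a geometric sum whose ratio is an `n`-th root of unity: it is `n` for ratio `1`
and vanishes otherwise. -/
lemma freqVec_dotProduct_freqVec_inv {α : F} (hα : IsPrimitiveRoot α n) (hn : 0 < n) (s t : ℕ) :
    freqVec n α⁻¹ s ⬝ᵥ freqVec n α t = if s ≡ t [MOD n] then (n : F) else 0 := by
  have hα0 := hα.ne_zero hn.ne'
  have h : freqVec n α⁻¹ s ⬝ᵥ freqVec n α t = ∑ j ∈ Finset.range n, (α ^ t / α ^ s) ^ j := by
    rw [Finset.sum_range]
    refine Finset.sum_congr rfl fun j _ => ?_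
    simp only [freqVec]
    rw [← mul_pow, inv_pow, div_eq_inv_mul]
  have hmod : α ^ t / α ^ s = 1 ↔ s ≡ t [MOD n] := by
    rw [div_eq_one_iff_eq (pow_ne_zero _ hα0), eq_comm,
      (isOfFinOrder_iff_pow_eq_one.mpr ⟨n, hn, hα.pow_eq_one⟩).pow_eq_pow_iff_modEq,
      ← hα.eq_orderOf]
  rw [h]
  split_ifs with hst
  · rw [hmod.mpr hst]; simp
  · have h1 : α ^ t / α ^ s ≠ 1 := fun h => hst (hmod.mp h)
    rw [geom_sum_eq h1, div_pow, ← pow_mul, ← pow_mul, mul_comm t, mul_comm s, pow_mul, pow_mul,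
      hα.pow_eq_one]
    simp

lemma freqVec_inv_eq {α : F} (hα : IsPrimitiveRoot α n) {s t : ℕ} (h : n ∣ s + t) :
    freqVec n α⁻¹ s = freqVec n α t := by
  have h1 : α ^ s * α ^ t = 1 := by rw [← pow_add, hα.pow_eq_one_iff_dvd]; exact h
  ext j
  rw [freqVec, freqVec, inv_pow, eq_inv_of_mul_eq_one_right h1]

/-- The frequencies at which words of `RS_k(n, b)` have a vanishing value. -/
def zeroFreqs (n k b : ℕ) : Finset (Fin n) :=
  Finset.univ.filter fun s => b ≤ s ∧ (s : ℕ) < b + (n - k)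

/-- The negatives modulo `n` of the frequencies `b, …, b + n - k - 1`. -/
def negZeroFreqs (n k b : ℕ) : Finset (Fin n) :=
  Finset.univ.filter fun s => ∃ i < n - k, n ∣ s + (b + i)

lemma exists_fin_dvd_add (hn : 0 < n) (m : ℕ) : ∃ s : Fin n, n ∣ s + m := by
  have hm := Nat.mod_lt m hn
  refine ⟨⟨(n - m % n) % n, Nat.mod_lt _ hn⟩, ?_⟩
  rw [Nat.dvd_iff_mod_eq_zero, Nat.mod_add_mod, ← Nat.add_mod_mod, Nat.sub_add_cancel hm.le,
    Nat.mod_self]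

/-- Two Reed-Solomon codes give a code whose parameters are determined by the sizes of the
intersection and of the union of their sets of stabiliser frequencies. -/
theorem reedSolomon_givesQuentaCode [Fintype F] [DecidableEq F] {α : F}
    (hα : IsPrimitiveRoot α n) {k₁ k₂ b₁ b₂ k c : ℕ}
    (hk₁ : 1 ≤ k₁) (hk₁n : k₁ ≤ n) (hk₂ : 1 ≤ k₂) (hk₂n : k₂ ≤ n) (hb₁ : b₁ ≤ k₁)
    (hc : (zeroFreqs n k₁ b₁ ∩ negZeroFreqs n k₂ b₂).card = c)
    (hk : (zeroFreqs n k₁ b₁ ∪ negZeroFreqs n k₂ b₂)ᶜ.card = k) :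
    GivesQuentaCode (reedSolomon α n k₁ b₁) (reedSolomon α n k₂ b₂) k (n - max k₁ k₂ + 1) c := by
  have hn : 0 < n := by omega
  have : NeZero n := ⟨hn.ne'⟩
  have hn0 : (n : F) ≠ 0 := hα.neZero'.out
  have hfe : ∀ s t : Fin n, ((n : F)⁻¹ • freqVec n α⁻¹ s) ⬝ᵥ freqVec n α t =
      if s = t then 1 else 0 := by
    intro s t
    rw [smul_dotProduct, freqVec_dotProduct_freqVec_inv hα hn, smul_eq_mul, mul_ite,
      inv_mul_cancel₀ hn0, mul_zero]
    refine if_congr ⟨fun h => Fin.ext (Nat.ModEq.eq_of_lt_of_lt h s.2 t.2), ?_⟩ rfl rfl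
    rintro rfl
    rfl
  have hf0 : ∀ (s : Fin n) (v : Fin n → F),
      ((n : F)⁻¹ • freqVec n α⁻¹ s) ⬝ᵥ v = 0 ↔ freqVec n α⁻¹ s ⬝ᵥ v = 0 := by
    intro s v
    rw [smul_dotProduct, smul_eq_mul, mul_eq_zero, inv_eq_zero, or_iff_right hn0]
  refine givesQuentaCode_of_biorthogonal (e := fun s => freqVec n α s)
    (f := fun s => (n : F)⁻¹ • freqVec n α⁻¹ s) hfe (A := zeroFreqs n k₁ b₁)
    (B := negZeroFreqs n k₂ b₂) (fun v => ?_) (fun v => ?_) hc hk (fun S hS t => ?_)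
    (fun S hS w hw hwS => ?_) ?_
  · rw [mem_reedSolomon_iff hα hk₁ hk₁n]
    constructor
    · intro h s hs
      simp only [zeroFreqs, Finset.mem_filter, Finset.mem_univ, true_and] at hs
      have := h (s - b₁) (by omega)
      rwa [Nat.add_sub_cancel' hs.1] at this
    · intro h i hi
      exact h ⟨b₁ + i, by omega⟩ (by simp [zeroFreqs, hi])
  · simp only [hf0]
    rw [mem_reedSolomon_iff hα hk₂ hk₂n]
    constructor
    · intro h s hs
      simp only [negZeroFreqs, Finset.mem_filter, Finset.mem_univ, true_and] at hs
      obtain ⟨i, hi, hd⟩ := hs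
      rw [freqVec_inv_eq hα hd]
      exact h i hi
    · intro h i hi
      obtain ⟨s, hs⟩ := exists_fin_dvd_add hn (b₂ + i)
      rw [← freqVec_inv_eq hα hs]
      refine h s ?_
      simp only [negZeroFreqs, Finset.mem_filter, Finset.mem_univ, true_and]
      exact ⟨i, hi, hs⟩
  · obtain ⟨p, hp⟩ := exists_sum_freqVec_eqOn hα b₁ (m := n - k₁) S (by omega) t
    refine ⟨_, fun s hs => ?_, hp⟩
    rw [hf0, dotProduct_sum]
    refine Finset.sum_eq_zero fun i hi => ?_
    rw [Finset.mem_range] at hi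
    rw [dotProduct_smul, freqVec_dotProduct_freqVec_inv hα hn, if_neg, smul_zero]
    intro h
    -- Here `b₁ ≤ k₁` matters: it keeps `b₁ + i` below `n`, so the zero frequencies of `C₁` do not
    -- wrap around.
    have := Nat.ModEq.eq_of_lt_of_lt h s.2 (by omega)
    refine hs ?_
    simp only [zeroFreqs, Finset.mem_filter, Finset.mem_univ, true_and]
    omega
  · rw [mem_reedSolomon_iff hα hk₂ hk₂n] at hw
    ext j
    by_cases hj : j ∈ S
    -- A parity check of `C₂` that equals the indicator of `j` on `S` reads off `w j`, which must
    -- therefore be `0`.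
    · obtain ⟨p, hp⟩ := exists_sum_freqVec_eqOn hα b₂ (m := n - k₂) S (by omega) (Pi.single j 1)
      have h0 : (∑ i ∈ Finset.range (n - k₂), p i • freqVec n α (b₂ + i)) ⬝ᵥ w = 0 := by
        rw [sum_dotProduct]
        refine Finset.sum_eq_zero fun i hi => ?_
        rw [smul_dotProduct, hw i (Finset.mem_range.mp hi), smul_zero]
      have h1 : (∑ i ∈ Finset.range (n - k₂), p i • freqVec n α (b₂ + i)) ⬝ᵥ w =
          Pi.single j 1 ⬝ᵥ w := by
        refine Finset.sum_congr rfl fun i _ => ?_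
        by_cases hi : i ∈ S
        · rw [hp i hi]
        · rw [hwS i hi, mul_zero, mul_zero]
      rw [h0, single_one_dotProduct] at h1
      exact h1.symm
    · exact hwS j hj
  · have hcard : ∀ m : ℕ, m < n → (Finset.univ.filter fun j : Fin n => (j : ℕ) ≤ m).card = m + 1 := by
      intro m hm
      have : (Finset.univ.filter fun j : Fin n => (j : ℕ) ≤ m) = Finset.Iic ⟨m, hm⟩ := by
        ext j; simp [Fin.le_def]
      rw [this, Fin.card_Iic]
    -- These are the positions of the coefficients of a generator polynomial of degree `n - max k₁
    -- k₂`.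
    refine ⟨Finset.univ.filter fun j : Fin n => (j : ℕ) ≤ n - max k₁ k₂,
      hcard _ (by omega), ?_⟩
    rcases le_or_gt k₁ k₂ with hle | hlt
    · refine ⟨generatorWord α n k₂ b₂, generatorWord_ne_zero α hk₂ hk₂n b₂, fun j hj => ?_,
        Or.inl ⟨generatorWord_mem α hk₂ hk₂n b₂, fun s _ hs => ?_⟩⟩
      · rw [max_eq_right hle] at hj
        exact generatorWord_apply_eq_zero α k₂ b₂ j (by simpa using hj)
      · rw [Ne, hf0, freqVec_dotProduct_generatorWord _ _ hk₂ hk₂n, Finset.prod_eq_zero_iff]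
        rintro ⟨i, hi, h⟩
        refine hs ?_
        simp only [negZeroFreqs, Finset.mem_filter, Finset.mem_univ, true_and]
        refine ⟨i, Finset.mem_range.mp hi, ?_⟩
        rw [← hα.pow_eq_one_iff_dvd, pow_add, ← sub_eq_zero.mp h, inv_pow,
          mul_inv_cancel₀ (pow_ne_zero _ (hα.ne_zero hn.ne'))]
    · refine ⟨generatorWord α n k₁ b₁, generatorWord_ne_zero α hk₁ hk₁n b₁, fun j hj => ?_,
        Or.inr ⟨generatorWord_mem α hk₁ hk₁n b₁, fun s hs _ => ?_⟩⟩
      · rw [max_eq_left hlt.le] at hj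
        exact generatorWord_apply_eq_zero α k₁ b₁ j (by simpa using hj)
      · rw [Ne, freqVec_dotProduct_generatorWord _ _ hk₁ hk₁n, Finset.prod_eq_zero_iff]
        rintro ⟨i, hi, h⟩
        rw [Finset.mem_range] at hi
        have := hα.pow_inj s.2 (by omega) (sub_eq_zero.mp h)
        refine hs ?_
        simp only [zeroFreqs, Finset.mem_filter, Finset.mem_univ, true_and]
        omega

/-- For `b ≤ k + 1` the sum `s + b + i` stays below `2 n`, so the multiple of `n` is `n` or `0`. The
value `0` forces `b = s = 0`: for `b = 0` the endpoint `n - b` wraps around to the frequency `0`. -/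
lemma mem_negZeroFreqs_iff {k b : ℕ} (hb : b ≤ k + 1) (s : Fin n) :
    s ∈ negZeroFreqs n k b ↔ (k + 1 ≤ s + b ∧ s + b ≤ n) ∨ (k < n ∧ b = 0 ∧ (s : ℕ) = 0) := by
  have hs := s.2
  simp only [negZeroFreqs, Finset.mem_filter, Finset.mem_univ, true_and]
  constructor
  · rintro ⟨i, hi, m, hm⟩
    have : m < 2 := by
      by_contra! h
      have := Nat.mul_le_mul_left n h
      omega
    interval_cases m <;> omega
  · rintro (h | h)
    · exact ⟨n - s - b, by omega, 1, by omega⟩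
    · exact ⟨0, by omega, 0, by omega⟩

lemma card_eq_of_val_mem_iff {T : Finset (Fin n)} {U : Finset ℕ} (hU : ∀ s ∈ U, s < n)
    (h : ∀ s : Fin n, s ∈ T ↔ (s : ℕ) ∈ U) : T.card = U.card := by
  rw [← Finset.card_map Fin.valEmbedding]
  congr 1
  ext s
  simp only [Finset.mem_map, Fin.valEmbedding_apply]
  constructor
  · rintro ⟨t, ht, rfl⟩
    exact (h t).mp ht
  · exact fun hs => ⟨⟨s, hU s hs⟩, (h _).mpr hs, rfl⟩

end ReedSolomon

/-! ### Counting frequencies in the two cases. -/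

theorem mainTheorem3 {F : Type*} [Field F] [Fintype F] [DecidableEq F]
    (n k₁ k₂ b₁ b₂ : ℕ) (α : F) (hα : IsPrimitiveRoot α n)
    (hk₁ : 1 ≤ k₁) (hk₁n : k₁ ≤ n) (hk₂ : 1 ≤ k₂) (hk₂n : k₂ ≤ n)
    (hb₁ : b₁ ≤ k₁) (hb : b₁ + b₂ ≤ k₂ + 1) :
    -- the two bounds in the first case say that the parameters `b₁ + b₂ - 1` and
    -- `n + b₁ + b₂ - k₁ - k₂ - 1` are nonnegative
    (b₂ ≤ k₁ - b₁ → 1 ≤ b₁ + b₂ → k₁ + k₂ + 1 ≤ n + b₁ + b₂ →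
      GivesQuentaCode (reedSolomon α n k₁ b₁) (reedSolomon α n k₂ b₂)
        (b₁ + b₂ - 1) (n - max k₁ k₂ + 1) (n + b₁ + b₂ - k₁ - k₂ - 1)) ∧
    (k₁ - b₁ < b₂ →
      GivesQuentaCode (reedSolomon α n k₁ b₁) (reedSolomon α n k₂ b₂)
        k₁ (n - max k₁ k₂ + 1) (n - k₂)) := by
  constructor
  · intro h1 h2 h3
    refine reedSolomon_givesQuentaCode hα hk₁ hk₁n hk₂ hk₂n hb₁ ?_ ?_
    -- `A = [b₁, n - k₁ + b₁)` starts and ends no later than `B = [k₂ + 1 - b₂, n - b₂]`, so they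
    -- meet from the start of `B` to the end of `A`. If `b₂ = 0`, the wrapped frequency `0` is not
    -- in `A`, since then `b₁ ≥ 1`.
    · rw [card_eq_of_val_mem_iff (U := Finset.Ico (k₂ + 1 - b₂) (n - k₁ + b₁))]
      · rw [Nat.card_Ico]; omega
      · intro s hs
        rw [Finset.mem_Ico] at hs
        omega
      · intro s
        have hs := s.2
        rw [Finset.mem_inter, mem_negZeroFreqs_iff (by omega), Finset.mem_Ico]
        simp only [zeroFreqs, Finset.mem_filter, Finset.mem_univ, true_and]
        omega
    -- By `h3` no gap is left between `A` and `B`, so only frequencies below `b₁` and above `n - b₂`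
    -- remain. For `b₂ = 0` nothing lies above, but `0` is taken by `B`.
    · rcases Nat.eq_zero_or_pos b₂ with h0 | hpos
      · rw [card_eq_of_val_mem_iff (U := Finset.Ico 1 b₁)]
        · rw [Nat.card_Ico]; omega
        · intro s hs
          rw [Finset.mem_Ico] at hs
          omega
        · intro s
          have hs := s.2
          rw [Finset.mem_compl, Finset.mem_union, mem_negZeroFreqs_iff (by omega), Finset.mem_Ico]
          simp only [zeroFreqs, Finset.mem_filter, Finset.mem_univ, true_and]
          omega
      · rw [card_eq_of_val_mem_iff (U := Finset.range b₁ ∪ Finset.Ico (n + 1 - b₂) n)]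
        · rw [Finset.card_union_of_disjoint, Finset.card_range, Nat.card_Ico]
          · omega
          · rw [Finset.disjoint_left]
            intro s hs hs'
            rw [Finset.mem_range] at hs
            rw [Finset.mem_Ico] at hs'
            omega
        · intro s hs
          rw [Finset.mem_union, Finset.mem_range, Finset.mem_Ico] at hs
          omega
        · intro s
          have hs := s.2
          rw [Finset.mem_compl, Finset.mem_union, mem_negZeroFreqs_iff (by omega),
            Finset.mem_union, Finset.mem_range, Finset.mem_Ico]
          simp only [zeroFreqs, Finset.mem_filter, Finset.mem_univ, true_and]
          omega
  · intro h
    refine reedSolomon_givesQuentaCode hα hk₁ hk₁n hk₂ hk₂n hb₁ ?_ ?_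
    -- Now `b₂ > 0` and `B` ends inside `A`, so `B ⊆ A`: the intersection is `B`, and the complement
    -- of the union is that of `A`.
    · rw [card_eq_of_val_mem_iff (U := Finset.Ico (k₂ + 1 - b₂) (n + 1 - b₂))]
      · rw [Nat.card_Ico]; omega
      · intro s hs
        rw [Finset.mem_Ico] at hs
        omega
      · intro s
        have hs := s.2
        rw [Finset.mem_inter, mem_negZeroFreqs_iff (by omega), Finset.mem_Ico]
        simp only [zeroFreqs, Finset.mem_filter, Finset.mem_univ, true_and]
        omega
    · rw [card_eq_of_val_mem_iff (U := Finset.range b₁ ∪ Finset.Ico (n - k₁ + b₁) n)]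
      · rw [Finset.card_union_of_disjoint, Finset.card_range, Nat.card_Ico]
        · omega
        · rw [Finset.disjoint_left]
          intro s hs hs'
          rw [Finset.mem_range] at hs
          rw [Finset.mem_Ico] at hs'
          omega
      · intro s hs
        rw [Finset.mem_union, Finset.mem_range, Finset.mem_Ico] at hs
        omega
      · intro s
        have hs := s.2
        rw [Finset.mem_compl, Finset.mem_union, mem_negZeroFreqs_iff (by omega),
          Finset.mem_union, Finset.mem_range, Finset.mem_Ico]
        simp only [zeroFreqs, Finset.mem_filter, Finset.mem_univ, true_and]
        omega
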